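/- Rings are associative and not necessarily unital. A ring $R$ is semiprime if it has no nonzero two-sided ideal of zero square. It has enough idempotents if it contains a complete set of idempotents, i.e. a set $\{e_\lambda\}_{\lambda\in\Lambda}$ of pairwise orthogonal idempotents with $R=\bigoplus_{\lambda\in\Lambda} Re_\lambda=\bigoplus_{\lambda\in\Lambda} e_\lambda R$. Let $R\text{-Mod}$ be the category of left $R$-modules $M$ that are unital ($RM=M$) and nondegenerate ($m\in M$ and $Rm=0$ imply $m=0$), a full subcategory of all left $R$-modules; rings $R$ and $S$ with enough idempotents are Morita equivalent if the categories $R\text{-Mod}$ and $S\text{-Mod}$ are equivalent. The ring $R$ is categorically left (resp. right) artinian if every finitely generated unital nondegenerate left (resp. right) $R$-module is artinian. **Theorem.** Let $R$ and $S$ be semiprime rings with enough idempotents that are Morita equivalent. If $R$ is categorically left (resp. right) artinian, then so is $S$. Moreover, if $R$ is a semiprime ring and $\{e_\lambda\}_{\lambda\in\Lambda}$ is a complete set of idempotents of $R$, then $R$ is categorically left (resp. right) artinian if and only if the ring $e_\lambda Re_\lambda$ is left (resp. right) artinian for every $\lambda\in\Lambda$. -/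

import Mathlib

/-!
Rings are associative and need not have an identity (`NonUnitalRing`).

A left module over such a ring `R` is an abelian group `M` with a biadditive map `R × M → M`
satisfying `(r s) m = r (s m)`.  This is the same thing as a (unitary) left module over the unital
ring `Unitization ℤ R = ℤ ⊕ R` obtained by freely adjoining an identity to `R`
(`Unitization.lift` is the universal property): `r` acts on `M` as `(0, r)`, and the integers act
in the only possible way.  Under this identification the subgroups of `M` stable under `R`
are exactly the `Unitization ℤ R`-submodules and the additive `R`-linear maps are exactly the
`Unitization ℤ R`-linear maps.  So the category of all left `R`-modules is
`ModuleCat (Unitization ℤ R)`.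

Right `R`-modules are left modules over the opposite ring `Rᵐᵒᵖ`.
-/

open MulOpposite

universe u w

/-- `R` is semiprime: it has no nonzero two-sided ideal of zero square. -/
def IsSemiprimeRing (R : Type u) [NonUnitalRing R] : Prop :=
  ∀ I : TwoSidedIdeal R, (∀ x ∈ I, ∀ y ∈ I, x * y = 0) → I = ⊥

open Classical in
/-- A family of pairwise orthogonal idempotents `e i` of `R` is complete if
`R = ⨁ R e i = ⨁ e i R` (internal direct sums of the subgroups `R e i = {r * e i}` and
`e i R = {e i * r}`). -/
structure IsCompleteIdempotents {R : Type u} [NonUnitalRing R] {ι : Type w} (e : ι → R) :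
    Prop where
  idem : ∀ i, IsIdempotentElem (e i)
  ortho : ∀ i j, i ≠ j → e i * e j = 0
  left : DirectSum.IsInternal fun i => (AddMonoidHom.mulRight (e i)).range
  right : DirectSum.IsInternal fun i => (AddMonoidHom.mulLeft (e i)).range

/-- `R` has enough idempotents: it contains a complete set of orthogonal idempotents. -/
def HasEnoughIdempotents (R : Type u) [NonUnitalRing R] : Prop :=
  ∃ E : Set R, IsCompleteIdempotents (fun e : E => (e : R))

/-- The left `R`-module `M` is unital: `M = R M`, i.e. `M` is additively generated by the
elements `r m`. -/
def IsUnitalModule (R : Type u) [NonUnitalRing R] (M : Type w) [AddCommGroup M]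
    [Module (Unitization ℤ R) M] : Prop :=
  AddSubgroup.closure {x : M | ∃ (r : R) (m : M), x = (r : Unitization ℤ R) • m} = ⊤

/-- The left `R`-module `M` is nondegenerate: `R m = 0` implies `m = 0`. -/
def IsNondegenerateModule (R : Type u) [NonUnitalRing R] (M : Type w) [AddCommGroup M]
    [Module (Unitization ℤ R) M] : Prop :=
  ∀ m : M, (∀ r : R, (r : Unitization ℤ R) • m = 0) → m = 0

/-- The category `R`-Mod: the full subcategory of the category of all left `R`-modules whose
objects are the unital nondegenerate modules. -/
abbrev RMod (R : Type u) [NonUnitalRing R] :=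
  CategoryTheory.ObjectProperty.FullSubcategory
    (fun M : ModuleCat.{u} (Unitization ℤ R) =>
      IsUnitalModule R M ∧ IsNondegenerateModule R M)

/-- The (idempotent) rings `R` and `S` are Morita equivalent: the categories `R`-Mod and `S`-Mod
are equivalent. -/
def MoritaEquivalent (R S : Type u) [NonUnitalRing R] [NonUnitalRing S] : Prop :=
  Nonempty (CategoryTheory.Equivalence (RMod R) (RMod S))

/-- `R` is categorically left artinian: every finitely generated module in `R`-Mod is artinian
(has the descending chain condition on `R`-submodules). -/
def IsCategoricallyLeftArtinian (R : Type u) [NonUnitalRing R] : Prop :=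
  ∀ (M : Type u) [AddCommGroup M] [Module (Unitization ℤ R) M],
    IsUnitalModule R M → IsNondegenerateModule R M →
    Module.Finite (Unitization ℤ R) M → IsArtinian (Unitization ℤ R) M

/-- `R` is categorically right artinian: every finitely generated unital nondegenerate right
`R`-module is artinian. -/
def IsCategoricallyRightArtinian (R : Type u) [NonUnitalRing R] : Prop :=
  IsCategoricallyLeftArtinian Rᵐᵒᵖ

/-- The property `P` of rings is Morita invariant in the class `C` of rings: whenever a ring of
`C` satisfies `P`, every Morita equivalent ring in `C` satisfies `P` too. -/
def IsMoritaInvariant (C P : ∀ (R : Type u) [NonUnitalRing R], Prop) : Prop :=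
  ∀ (R S : Type u) [NonUnitalRing R] [NonUnitalRing S],
    C R → C S → MoritaEquivalent R S → P R → P S

/-- The class of semiprime rings with enough idempotents. -/
def IsSemiprimeWithEnoughIdempotents (R : Type u) [NonUnitalRing R] : Prop :=
  IsSemiprimeRing R ∧ HasEnoughIdempotents R

/-!
Let `R` be semiprime with local units and let `U` be its unitization, which contains `R` as an
ideal; `R`-modules are `U`-modules. For an idempotent `e` of `R` one has `e R e = e U e`, and `U e`
is a finitely generated object of `R`-Mod.

If `U e` is artinian then so is the ring `e R e`, because a left ideal `I` is recovered from `U I`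
as `e U I` (`IsIdempotentElem.isArtinianRing_corner`). Conversely, let `e R e` be left artinian. It
inherits the elementwise form of semiprimeness (`a A a = 0` only for `a = 0`), so its radical, being
nilpotent, vanishes and `e R e` is semisimple. For a submodule `N` of `U e` the left ideal `e N` is
then generated by an idempotent `g`, and semiprimeness forces `N = U g`; so `N ↦ e N` is strictly
monotone and `U e` is artinian (`IsIdempotentElem.isArtinian_span`). As a finitely generated unital
module is a finite sum of images of modules `U (e i)`, this proves the characterization by corners
(`IsLocalUnitFamily.isCategoricallyLeftArtinian_iff`). The right-hand version is the left-hand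
version for `Rᵐᵒᵖ`.

In the presence of local units `R`-Mod is closed under submodules, so the categorical subobjects of
a module are its submodules. An equivalence of categories therefore preserves submodule lattices.
Artinian modules are those whose lattice is well-founded, and finitely generated modules are those
whose top submodule is compact; so the left artinian condition is Morita invariant
(`ModuleCat.isArtinian_of_equivalence`).

The equivalence is one of left modules. For the right artinian condition one uses that a semiprime
unital ring is left artinian if and only if it is semisimple, a left-right symmetric condition. Applied to
the corners, this makes the left and the right condition equivalent for semiprime rings with local
units (`IsLocalUnitFamily.isCategoricallyRightArtinian_iff_left`).
-/

/-! ### Unital rings: corners and artinian cyclic projectives -/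

/-- An artinian ring `A` in which `a A a = 0` forces `a = 0` is semisimple. -/
theorem isSemisimpleRing_of_isArtinianRing {A : Type*} [Ring A] [IsArtinianRing A]
    (hA : ∀ a : A, (∀ x, a * x * a = 0) → a = 0) : IsSemisimpleRing A := by
  rw [IsArtinianRing.isSemisimpleRing_iff_jacobson]
  have hnil : IsNilpotent (Ring.jacobson A) := IsSemiprimaryRing.isNilpotent
  by_contra hne
  -- Let `n + 1` be the nilpotency index of the radical `J`. If `J ≠ 0` then `n ≥ 1`, and
  -- `a A a ⊆ Jⁿ Jⁿ ⊆ Jⁿ⁺¹ = 0` for every `a ∈ Jⁿ`, so that `Jⁿ = 0`.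
  obtain ⟨n, hn, hlt⟩ : ∃ n, Ring.jacobson A ^ (n + 1) = 0 ∧ Ring.jacobson A ^ n ≠ 0 := by
    classical
    have h0 : Nat.find hnil ≠ 0 := by
      intro h0
      have h := Nat.find_spec hnil
      rw [h0, Submodule.pow_zero] at h
      refine hne (eq_bot_iff.2 fun x _ => ?_)
      have h1 : (1 : A) ∈ (1 : Ideal A) := by simp
      rw [h] at h1
      have h1' : (1 : A) = 0 := by simpa using h1
      have : x = 0 := by rw [← mul_one x, h1', mul_zero]
      simpa using this
    obtain ⟨m, hm⟩ := Nat.exists_eq_succ_of_ne_zero h0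
    have h := Nat.find_spec hnil
    rw [hm] at h
    exact ⟨m, h, Nat.find_min hnil (by omega)⟩
  have hn0 : n ≠ 0 := by
    rintro rfl
    rw [zero_add, Submodule.pow_one] at hn
    exact hne hn
  refine hlt (eq_bot_iff.2 fun a ha => ?_)
  refine (Submodule.mem_bot A).2 (hA a fun x => ?_)
  have hmem : a * (x * a) ∈ Ring.jacobson A ^ n * Ring.jacobson A ^ n :=
    Ideal.mul_mem_mul ha (Ideal.mul_mem_left _ x ha)
  have hle : Ring.jacobson A ^ n * Ring.jacobson A ^ n ≤ Ring.jacobson A ^ (n + 1) := by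
    rw [← Ideal.IsTwoSided.pow_add]
    exact Ideal.pow_le_pow_right (by omega)
  have h := hle hmem
  rw [hn] at h
  simpa [mul_assoc] using h

/-- In a ring with `a A a ≠ 0` for all `a ≠ 0`, the left and the right artinian condition coincide:
both mean that `A` is semisimple. -/
theorem isArtinianRing_op_iff {A : Type*} [Ring A] (hA : ∀ a : A, (∀ x, a * x * a = 0) → a = 0) :
    IsArtinianRing Aᵐᵒᵖ ↔ IsArtinianRing A := by
  constructor
  · intro _
    have : IsSemisimpleRing Aᵐᵒᵖ := isSemisimpleRing_of_isArtinianRing fun a ha =>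
      unop_injective (hA a.unop fun x => by simpa [mul_assoc] using congrArg unop (ha (op x)))
    have : IsSemisimpleRing A := isSemisimpleRing_mulOpposite_iff.1 this
    infer_instance
  · intro _
    have := isSemisimpleRing_of_isArtinianRing hA
    infer_instance

theorem IsIdempotentElem.corner_mul_mul_eq_zero {R : Type*} [NonUnitalRing R] {f : R}
    (hf : IsIdempotentElem f) {a : hf.Corner} (ha : ∀ x, a * x * a = 0) (u : R) :
    a.1 * u * a.1 = 0 := by
  have ha' := (Subsemigroup.mem_corner_iff hf).1 a.2
  have := congrArg Subtype.val (ha ⟨f * u * f, u, rfl⟩)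
  change a.1 * (f * u * f) * a.1 = 0 at this
  rwa [← mul_assoc, ← mul_assoc, ha'.2, mul_assoc _ f, ha'.1] at this

section Corner

variable {U : Type*} [Ring U] {f : U} (hf : IsIdempotentElem f)
include hf

theorem IsIdempotentElem.mem_span_singleton_iff {x : U} :
    x ∈ Submodule.span U {f} ↔ x * f = x := by
  rw [Submodule.mem_span_singleton]
  constructor
  · rintro ⟨a, rfl⟩
    simp [mul_assoc, hf.eq]
  · exact fun h => ⟨x, h⟩

/-- If the left ideal `U f` is artinian then so is the ring `f U f`: a left ideal `I` of `f U f`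
is recovered from the submodule `U I` of `U f` as `f U I`. -/
theorem IsIdempotentElem.isArtinianRing_corner (h : IsArtinian U (Submodule.span U {f})) :
    IsArtinianRing hf.Corner := by
  let φ : Ideal hf.Corner → Submodule U (Submodule.span U {f}) := fun I =>
    (Submodule.span U (Subtype.val '' (I : Set hf.Corner))).comap (Submodule.subtype _)
  have key : ∀ (I : Ideal hf.Corner) (x : U),
      x ∈ Submodule.span U (Subtype.val '' (I : Set hf.Corner)) →
        ∀ v : U, ∃ b ∈ I, (b : hf.Corner).1 = f * v * x := by
    intro I x hx
    induction hx using Submodule.span_induction with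
    | mem x hx =>
      obtain ⟨b, hb, rfl⟩ := hx
      intro v
      refine ⟨(⟨f * v * f, v, rfl⟩ : hf.Corner) * b, I.mul_mem_left _ hb, ?_⟩
      change f * v * f * b.1 = f * v * b.1
      rw [mul_assoc (f * v), ((Subsemigroup.mem_corner_iff hf).1 b.2).1]
    | zero => exact fun v => ⟨0, I.zero_mem, (mul_zero _).symm⟩
    | add x y _ _ hx hy =>
      intro v
      obtain ⟨b, hb, hb'⟩ := hx v
      obtain ⟨c, hc, hc'⟩ := hy v
      refine ⟨b + c, I.add_mem hb hc, ?_⟩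
      change b.1 + c.1 = _
      rw [hb', hc', mul_add]
    | smul u x _ hx =>
      intro v
      obtain ⟨b, hb, hb'⟩ := hx (v * u)
      exact ⟨b, hb, by rw [hb', smul_eq_mul]; simp only [mul_assoc]⟩
  have hφ : ∀ I J, φ I ≤ φ J → I ≤ J := by
    intro I J hIJ a ha
    have ha' := (Subsemigroup.mem_corner_iff hf).1 a.2
    have hmem : (⟨a.1, hf.mem_span_singleton_iff.2 ha'.2⟩ : Submodule.span U {f}) ∈ φ I :=
      Submodule.subset_span ⟨a, ha, rfl⟩
    obtain ⟨b, hb, hb'⟩ := key J a.1 (hIJ hmem) 1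
    have : b = a := Subtype.ext (by rw [hb', mul_one, ha'.1])
    exact this ▸ hb
  have hmono : StrictMono φ := by
    intro I J hIJ
    refine lt_of_le_not_ge ?_ fun hle => hIJ.not_ge (hφ _ _ hle)
    exact Submodule.comap_mono (Submodule.span_mono (Set.image_mono hIJ.le))
  exact hmono.wellFoundedLT

/-- Suppose that `y ∈ U f` and `y U y = 0` imply `y = 0`. If the ring `f U f` is left artinian
then so is the left ideal `U f`. Indeed `f U f` is semisimple, so for each submodule `N` of `U f`
the left ideal `f N` is generated by an idempotent `g`; every `y = x - x g` with `x ∈ N` then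
satisfies `f U y = 0`, hence `y U y = 0` and `y = 0`. Thus `N = U g` is determined by `f N`. -/
theorem IsIdempotentElem.isArtinian_span (hU : ∀ y : U, y * f = y → (∀ u, y * u * y = 0) → y = 0)
    (h : IsArtinianRing hf.Corner) : IsArtinian U (Submodule.span U {f}) := by
  have hss : IsSemisimpleRing hf.Corner :=
    isSemisimpleRing_of_isArtinianRing fun a ha => Subtype.ext
      (hU a.1 ((Subsemigroup.mem_corner_iff hf).1 a.2).2 fun u => hf.corner_mul_mul_eq_zero ha u)
  let φ : Submodule U (Submodule.span U {f}) → Ideal hf.Corner := fun N =>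
    { carrier := {a | ∃ x ∈ N, a.1 = x.1}
      zero_mem' := ⟨0, N.zero_mem, rfl⟩
      add_mem' := by
        rintro a b ⟨x, hx, hax⟩ ⟨y, hy, hby⟩
        exact ⟨x + y, N.add_mem hx hy, congrArg₂ (· + ·) hax hby⟩
      smul_mem' := by
        rintro c a ⟨x, hx, hax⟩
        exact ⟨c.1 • x, N.smul_mem _ hx, congrArg (c.1 * ·) hax⟩ }
  have hmono : Monotone φ := fun N N' hN a ⟨x, hx, hax⟩ => ⟨x, hN hx, hax⟩
  have hφ : ∀ N N', N ≤ N' → φ N' ≤ φ N → N' ≤ N := by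
    intro N N' hN hle x hx
    obtain ⟨g, hg, hspan⟩ := IsSemisimpleRing.ideal_eq_span_idempotent (φ N)
    have hgN : g ∈ φ N := hspan ▸ Ideal.subset_span rfl
    have hmul : ∀ a ∈ φ N, a.1 * g.1 = a.1 := by
      intro a ha
      rw [hspan, Ideal.mem_span_singleton'] at ha
      obtain ⟨b, rfl⟩ := ha
      exact congrArg Subtype.val (show b * g * g = b * g by rw [mul_assoc, hg.eq])
    obtain ⟨z, hz, hgz⟩ := hgN
    have hxf := hf.mem_span_singleton_iff.1 x.2
    have hgf := ((Subsemigroup.mem_corner_iff hf).1 g.2).2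
    have hfx : ∀ u : U, f * u * x.1 * g.1 = f * u * x.1 := fun u =>
      hmul ⟨f * u * x.1, f * u * x.1, by
        simp only [← mul_assoc, hf.eq]
        simp only [mul_assoc, hxf]⟩ (hle ⟨(f * u) • x, N'.smul_mem _ hx, rfl⟩)
    have hgg : g.1 * g.1 = g.1 := congrArg Subtype.val hg.eq
    have hy : x.1 - x.1 * g.1 = 0 := by
      have hyf : (x.1 - x.1 * g.1) * f = x.1 - x.1 * g.1 := by
        rw [sub_mul, hxf, mul_assoc, hgf]
      refine hU _ hyf fun u => ?_
      have hzero : f * u * (x.1 - x.1 * g.1) = 0 := by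
        rw [mul_sub, ← mul_assoc, hfx, sub_self]
      rw [← hyf, mul_assoc _ f u, hyf, mul_assoc, hzero, mul_zero]
    have : x = x.1 • z := Subtype.ext (by
      change x.1 = x.1 * z.1
      rw [← hgz]
      exact sub_eq_zero.1 hy)
    rw [this]
    exact N.smul_mem _ hz
  have hstrict : StrictMono φ := fun N N' hlt =>
    lt_of_le_not_ge (hmono hlt.le) fun hle => hlt.not_ge (hφ N N' hlt.le hle)
  exact hstrict.wellFoundedLT

end Corner

/-! ### Local units -/

/-- The family `e` consists of idempotents whose finite sums act as local identities:
for each `x`, all sufficiently large finite partial sums of `e` fix `x` from the left and from the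
right. In contrast to `IsCompleteIdempotents`, this condition is visibly left-right symmetric. -/
structure IsLocalUnitFamily {R : Type u} [NonUnitalRing R] {ι : Type w} (e : ι → R) : Prop where
  idem : ∀ i, IsIdempotentElem (e i)
  left : ∀ x, ∃ F : Finset ι, ∀ G, F ⊆ G → (∑ i ∈ G, e i) * x = x
  right : ∀ x, ∃ F : Finset ι, ∀ G, F ⊆ G → x * ∑ i ∈ G, e i = x

theorem IsLocalUnitFamily.op {R : Type u} [NonUnitalRing R] {ι : Type w} {e : ι → R}
    (he : IsLocalUnitFamily e) : IsLocalUnitFamily fun i => op (e i) where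
  idem i := congrArg MulOpposite.op (he.idem i).eq
  left x := by
    obtain ⟨F, hF⟩ := he.right x.unop
    exact ⟨F, fun G hG => unop_injective (by simpa using hF G hG)⟩
  right x := by
    obtain ⟨F, hF⟩ := he.left x.unop
    exact ⟨F, fun G hG => unop_injective (by simpa using hF G hG)⟩

/-- For an additive family of operators `T`, the elements fixed by all sufficiently large finite
partial sums of `T` form a subgroup. -/
theorem exists_finset_of_mem_closure {M : Type*} [AddCommGroup M] {ι : Type*} (T : ι → M →+ M)
    {s : Set M} (hs : ∀ x ∈ s, ∃ F : Finset ι, ∀ G, F ⊆ G → (∑ i ∈ G, T i) x = x) {x : M}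
    (hx : x ∈ AddSubgroup.closure s) : ∃ F : Finset ι, ∀ G, F ⊆ G → (∑ i ∈ G, T i) x = x := by
  classical
  induction hx using AddSubgroup.closure_induction with
  | mem x hx => exact hs x hx
  | zero => exact ⟨∅, fun G _ => map_zero _⟩
  | add x y _ _ hx hy =>
    obtain ⟨F, hF⟩ := hx
    obtain ⟨F', hF'⟩ := hy
    refine ⟨F ∪ F', fun G hG => ?_⟩
    rw [map_add, hF G (Finset.union_subset_left hG), hF' G (Finset.union_subset_right hG)]
  | neg x _ hx =>
    obtain ⟨F, hF⟩ := hx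
    exact ⟨F, fun G hG => by rw [map_neg, hF G hG]⟩

theorem DirectSum.IsInternal.mem_closure {M : Type*} [AddCommGroup M] {ι : Type*} [DecidableEq ι]
    {A : ι → AddSubgroup M} (h : DirectSum.IsInternal A) (x : M) :
    x ∈ AddSubgroup.closure {y | ∃ i, y ∈ A i} := by
  obtain ⟨v, rfl⟩ := h.surjective x
  induction v using DirectSum.induction_on with
  | zero => simp
  | of i y =>
    rw [DirectSum.coeAddMonoidHom_of]
    exact AddSubgroup.subset_closure ⟨i, y.2⟩
  | add v v' hv hv' =>
    rw [map_add]
    exact AddSubgroup.add_mem _ hv hv'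

theorem IsCompleteIdempotents.isLocalUnitFamily {R : Type u} [NonUnitalRing R] {ι : Type w}
    {e : ι → R} (he : IsCompleteIdempotents e) : IsLocalUnitFamily e where
  idem := he.idem
  left x := by
    classical
    obtain ⟨F, hF⟩ := exists_finset_of_mem_closure (fun i => AddMonoidHom.mulLeft (e i))
      (s := {y | ∃ i, y ∈ (AddMonoidHom.mulLeft (e i)).range}) (by
        rintro _ ⟨i, r, rfl⟩
        refine ⟨{i}, fun G hG => ?_⟩
        rw [AddMonoidHom.finsetSum_apply, Finset.sum_eq_single i]
        · simp [← mul_assoc, (he.idem i).eq]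
        · intro j _ hj
          simp [← mul_assoc, he.ortho j i hj]
        · exact fun hi => absurd (hG (Finset.mem_singleton_self i)) hi)
      (he.right.mem_closure x)
    refine ⟨F, fun G hG => ?_⟩
    simpa [AddMonoidHom.finsetSum_apply, Finset.sum_mul] using hF G hG
  right x := by
    classical
    obtain ⟨F, hF⟩ := exists_finset_of_mem_closure (fun i => AddMonoidHom.mulRight (e i))
      (s := {y | ∃ i, y ∈ (AddMonoidHom.mulRight (e i)).range}) (by
        rintro _ ⟨i, r, rfl⟩
        refine ⟨{i}, fun G hG => ?_⟩
        rw [AddMonoidHom.finsetSum_apply, Finset.sum_eq_single i]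
        · simp [mul_assoc, (he.idem i).eq]
        · intro j _ hj
          simp [mul_assoc, he.ortho i j hj.symm]
        · exact fun hi => absurd (hG (Finset.mem_singleton_self i)) hi)
      (he.left.mem_closure x)
    refine ⟨F, fun G hG => ?_⟩
    simpa [AddMonoidHom.finsetSum_apply, Finset.mul_sum] using hF G hG

theorem IsSemiprimeRing.op {R : Type u} [NonUnitalRing R] (hR : IsSemiprimeRing R) :
    IsSemiprimeRing Rᵐᵒᵖ := by
  intro I hI
  let J : TwoSidedIdeal R := TwoSidedIdeal.mk' {x | MulOpposite.op x ∈ I} I.zero_mem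
    (fun hx hy => I.add_mem hx hy) (fun hx => I.neg_mem hx)
    (fun {x y} hy => I.mul_mem_right (MulOpposite.op y) (MulOpposite.op x) hy)
    (fun {x y} hx => I.mul_mem_left (MulOpposite.op y) (MulOpposite.op x) hx)
  have hmem : ∀ x, x ∈ J ↔ MulOpposite.op x ∈ I := fun x => TwoSidedIdeal.mem_mk' _ _ _ _ _ _ x
  have hJ : J = ⊥ := hR J fun x hx y hy =>
    op_injective (hI _ ((hmem y).1 hy) _ ((hmem x).1 hx))
  refine eq_bot_iff.2 fun x hx => ?_
  have h0 : x.unop ∈ (⊥ : TwoSidedIdeal R) := hJ ▸ (hmem x.unop).2 hx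
  rw [TwoSidedIdeal.mem_bot] at h0
  exact (TwoSidedIdeal.mem_bot _).2 (unop_injective h0)

/-- The elementwise form of semiprimeness. -/
theorem IsSemiprimeRing.eq_zero {R : Type u} [NonUnitalRing R] (hR : IsSemiprimeRing R)
    {ι : Type w} {e : ι → R} (he : IsLocalUnitFamily e) {a : R} (ha : ∀ r, a * r * a = 0) :
    a = 0 := by
  -- The two-sided ideal `I` generated by `a` lies in `J = {x | a R x = 0}`. Hence `a`, and then all
  -- of `I`, lies in `K = {y | y R I = 0}`. Local units turn `I R I = 0` into `I I = 0`.
  let I : TwoSidedIdeal R := TwoSidedIdeal.span {a}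
  let J : TwoSidedIdeal R := TwoSidedIdeal.mk' {x | ∀ r, a * r * x = 0} (fun r => mul_zero _)
    (fun hx hy r => by rw [mul_add, hx r, hy r, add_zero])
    (fun hx r => by rw [mul_neg, hx r, neg_zero])
    (fun {x y} hy r => by rw [← mul_assoc, mul_assoc a, hy])
    (fun {x y} hx r => by rw [← mul_assoc, hx, zero_mul])
  have hJ : ∀ x ∈ I, ∀ r, a * r * x = 0 := fun x hx =>
    (TwoSidedIdeal.mem_mk' _ _ _ _ _ _ x).1
      (TwoSidedIdeal.mem_span_iff.1 hx J
        (Set.singleton_subset_iff.2 ((TwoSidedIdeal.mem_mk' _ _ _ _ _ _ a).2 ha)))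
  let K : TwoSidedIdeal R := TwoSidedIdeal.mk' {y | ∀ x ∈ I, ∀ r, y * r * x = 0}
    (fun x _ r => by rw [zero_mul, zero_mul])
    (fun hy hz x hx r => by rw [add_mul, add_mul, hy x hx r, hz x hx r, add_zero])
    (fun hy x hx r => by rw [neg_mul, neg_mul, hy x hx r, neg_zero])
    (fun {s y} hy x hx r => by rw [mul_assoc s, mul_assoc s, hy x hx, mul_zero])
    (fun {y s} hy x hx r => by rw [mul_assoc y, hy x hx])
  have hK : ∀ y ∈ I, ∀ x ∈ I, ∀ r, y * r * x = 0 := fun y hy =>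
    (TwoSidedIdeal.mem_mk' _ _ _ _ _ _ y).1
      (TwoSidedIdeal.mem_span_iff.1 hy K
        (Set.singleton_subset_iff.2 ((TwoSidedIdeal.mem_mk' _ _ _ _ _ _ a).2 hJ)))
  have hI : I = ⊥ := hR I fun x hx y hy => by
    obtain ⟨F, hF⟩ := he.right x
    rw [← hF F subset_rfl]
    exact hK x hx y hy _
  have haI : a ∈ I := TwoSidedIdeal.subset_span rfl
  rwa [hI, TwoSidedIdeal.mem_bot] at haI

/-! ### Corners of a left ideal -/

section Corners

variable {R : Type*} [NonUnitalRing R]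

/-- Let `j` embed `R` as a left ideal into the ring `U`. Then an idempotent `f` of `R` satisfies
`f R f = f U f`. -/
noncomputable def IsIdempotentElem.cornerEquivMap {U : Type*} [Ring U] (j : R →ₙ+* U)
    (hj : Function.Injective j) (hideal : ∀ (v : U) (x : R), ∃ y, v * j x = j y) {f : R}
    (hf : IsIdempotentElem f) : hf.Corner ≃+* (hf.map j).Corner :=
  RingEquiv.ofBijective
    ({ toFun := fun a => ⟨j a.1, by
          obtain ⟨_, r, rfl⟩ := a
          exact ⟨j r, by simp⟩⟩
       map_mul' := fun a b => Subtype.ext (map_mul j a.1 b.1)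
       map_add' := fun a b => Subtype.ext (map_add j a.1 b.1)
       map_zero' := Subtype.ext (map_zero j)
       map_one' := rfl } : hf.Corner →+* (hf.map j).Corner)
    ⟨fun a b h => Subtype.ext (hj (congrArg Subtype.val h)), by
      rintro ⟨x, hx⟩
      have hx' := (Subsemigroup.mem_corner_iff (hf.map j)).1 hx
      obtain ⟨y, hy⟩ := hideal x f
      rw [hx'.2] at hy
      subst hy
      refine ⟨⟨y, (Subsemigroup.mem_corner_iff hf).2 ⟨?_, ?_⟩⟩, rfl⟩
      · exact hj (by rw [map_mul, hx'.1])
      · exact hj (by rw [map_mul, hx'.2])⟩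

/-- The opposite of `f R f` is the corner of `Rᵐᵒᵖ` at `f`. -/
def IsIdempotentElem.cornerOpEquiv {f : R} (hf : IsIdempotentElem f)
    (hf' : IsIdempotentElem (op f)) : hf.Cornerᵐᵒᵖ ≃+* hf'.Corner where
  toFun a := ⟨op a.unop.1, by
    have h := (Subsemigroup.mem_corner_iff hf).1 a.unop.2
    exact (Subsemigroup.mem_corner_iff hf').2 ⟨congrArg op h.2, congrArg op h.1⟩⟩
  invFun a := op ⟨a.1.unop, by
    have h := (Subsemigroup.mem_corner_iff hf').1 a.2
    exact (Subsemigroup.mem_corner_iff hf).2 ⟨congrArg unop h.2, congrArg unop h.1⟩⟩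
  left_inv _ := rfl
  right_inv _ := rfl
  map_mul' _ _ := rfl
  map_add' _ _ := rfl

end Corners

/-! ### Unital modules over a ring with local units -/

section Modules

variable {R : Type u} [NonUnitalRing R] {U : Type*} [Ring U] (j : R →ₙ+* U)

/-- Let `U` be a ring and `j : R → U` a ring homomorphism. The `U`-module `M` is unital over `R`:
it is additively generated by the elements `j r • m`. For the embedding of `R` into
`Unitization ℤ R` this is `IsUnitalModule`. -/
def IsUnitalVia (M : Type*) [AddCommGroup M] [Module U M] : Prop :=
  AddSubgroup.closure {x : M | ∃ (r : R) (m : M), x = j r • m} = ⊤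

/-- The `U`-module `M` is nondegenerate over `R`: only `0` is annihilated by `j R`. For the
embedding of `R` into `Unitization ℤ R` this is `IsNondegenerateModule`. -/
def IsNondegenerateVia (M : Type*) [AddCommGroup M] [Module U M] : Prop :=
  ∀ m : M, (∀ r : R, j r • m = 0) → m = 0

variable {j}

theorem IsNondegenerateVia.submodule {M : Type*} [AddCommGroup M] [Module U M]
    (hM : IsNondegenerateVia j M) (N : Submodule U M) : IsNondegenerateVia j N := fun _ hn =>
  Subtype.ext (hM _ fun r => congrArg Subtype.val (hn r))

variable {ι : Type w} {e : ι → R} (he : IsLocalUnitFamily e)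
include he

theorem IsLocalUnitFamily.exists_smul_eq {M : Type*} [AddCommGroup M] [Module U M]
    (hM : IsUnitalVia j M) (m : M) : ∃ g : R, j g • m = m := by
  have hm : m ∈ AddSubgroup.closure {x : M | ∃ (r : R) (m : M), x = j r • m} := by
    rw [show AddSubgroup.closure _ = ⊤ from hM]
    trivial
  obtain ⟨F, hF⟩ := exists_finset_of_mem_closure
    (fun i => DistribSMul.toAddMonoidHom M (j (e i))) (by
      rintro _ ⟨r, m, rfl⟩
      obtain ⟨F, hF⟩ := he.left r
      refine ⟨F, fun G hG => ?_⟩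
      simp only [AddMonoidHom.finsetSum_apply, DistribSMul.toAddMonoidHom_apply, smul_smul,
        ← Finset.sum_smul, ← map_mul, ← map_sum, ← Finset.sum_mul, hF G hG]) hm
  refine ⟨∑ i ∈ F, e i, ?_⟩
  have := hF F subset_rfl
  simpa only [AddMonoidHom.finsetSum_apply, DistribSMul.toAddMonoidHom_apply,
        ← Finset.sum_smul, ← map_sum] using this

/-- Over a ring with local units, submodules of unital modules are unital. -/
theorem IsLocalUnitFamily.isUnitalVia_submodule {M : Type*} [AddCommGroup M] [Module U M]
    (hM : IsUnitalVia j M) (N : Submodule U M) : IsUnitalVia j N := by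
  refine eq_top_iff.2 fun n _ => AddSubgroup.subset_closure ?_
  obtain ⟨g, hg⟩ := he.exists_smul_eq hM n.1
  exact ⟨g, n, Subtype.ext hg.symm⟩

/-- If `j R` is a left ideal of `U`, then `R` fixes each element of `U f`, where `f ∈ R` is
idempotent, from the left. -/
theorem IsLocalUnitFamily.exists_mul_eq_of_mem_span
    (hideal : ∀ (v : U) (x : R), ∃ y, v * j x = j y) {f : R} (hf : IsIdempotentElem f) {x : U}
    (hx : x ∈ Submodule.span U {j f}) : ∃ g, j g * x = x := by
  obtain ⟨y, hy⟩ := hideal x f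
  rw [(hf.map j).mem_span_singleton_iff.1 hx] at hy
  obtain ⟨F, hF⟩ := he.left y
  exact ⟨∑ i ∈ F, e i, by rw [hy, ← map_mul, hF F subset_rfl]⟩

/-- If the left ideals `U (e i)` are artinian then so is every finitely generated unital module,
being a sum of finitely many cyclic submodules `U (e i) m`. -/
theorem IsLocalUnitFamily.isArtinian_of_finite
    (h : ∀ i, IsArtinian U (Submodule.span U {j (e i)}))
    {M : Type*} [AddCommGroup M] [Module U M] (hM : IsUnitalVia j M)
    [Module.Finite U M] : IsArtinian U M := by
  have hsingle : ∀ m : M, IsArtinian U (Submodule.span U {m}) := by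
    intro m
    obtain ⟨r, hr⟩ := he.exists_smul_eq hM m
    obtain ⟨F, hF⟩ := he.right r
    let φ : U →ₗ[U] M := LinearMap.toSpanSingleton _ _ m
    let N : F → Submodule U M := fun i => (Submodule.span U {j (e i.1)}).map φ
    have hN : ∀ i, IsArtinian U (N i) := fun i => by
      have := h i.1
      exact isArtinian_of_surjective _ (φ.submoduleMap (Submodule.span U {j (e i.1)}))
        (φ.submoduleMap_surjective _)
    refine isArtinian_of_le (t := ⨆ i, N i) ?_
    rw [Submodule.span_singleton_le_iff_mem, ← hr, ← hF F subset_rfl, Finset.mul_sum,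
      map_sum, Finset.sum_smul]
    refine Submodule.sum_mem _ fun i hi => Submodule.mem_iSup_of_mem (⟨i, hi⟩ : F) ?_
    refine ⟨j (r * e i), ?_, rfl⟩
    rw [map_mul]
    exact Submodule.smul_mem _ _ (Submodule.mem_span_singleton_self _)
  have htop : IsArtinian U (⊤ : Submodule U M) :=
    Submodule.fg_induction (motive := fun N _ => IsArtinian U N) hsingle
      (fun N₁ N₂ _ _ h₁ h₂ => isArtinian_sup N₁ N₂) ⊤ Module.Finite.fg_top
  exact isArtinian_of_linearEquiv Submodule.topEquiv

end Modules

/-- Let `R` be semiprime, embedded as a left ideal into the ring `U`. The finitely generated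
`U`-modules which are unital and nondegenerate over `R` are artinian if and only if the corners
`e i R e i` are left artinian. -/
theorem IsLocalUnitFamily.forall_isArtinian_iff {R U : Type u} [NonUnitalRing R] [Ring U]
    {j : R →ₙ+* U} (hj : Function.Injective j) (hideal : ∀ (v : U) (x : R), ∃ y, v * j x = j y)
    {ι : Type w} {e : ι → R} (he : IsLocalUnitFamily e) (hR : IsSemiprimeRing R) :
    (∀ (M : Type u) [AddCommGroup M] [Module U M], IsUnitalVia j M → IsNondegenerateVia j M →
      Module.Finite U M → IsArtinian U M) ↔ ∀ i, IsArtinianRing (he.idem i).Corner := by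
  constructor
  · intro h i
    have hfin : Module.Finite U (Submodule.span U {j (e i)}) :=
      Module.Finite.iff_fg.2 (Submodule.fg_span_singleton _)
    have hfix := fun x : Submodule.span U {j (e i)} =>
      he.exists_mul_eq_of_mem_span hideal (he.idem i) x.2
    have hart := h (Submodule.span U {j (e i)})
      (eq_top_iff.2 fun x _ => AddSubgroup.subset_closure <|
        let ⟨g, hg⟩ := hfix x; ⟨g, x, Subtype.ext hg.symm⟩)
      (fun x hx => let ⟨g, hg⟩ := hfix x
        Subtype.ext (hg.symm.trans (congrArg Subtype.val (hx g)))) hfin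
    have := ((he.idem i).map j).isArtinianRing_corner hart
    exact ((he.idem i).cornerEquivMap j hj hideal).symm.isArtinianRing
  · intro h M _ _ hM _ _
    refine he.isArtinian_of_finite (fun i => ?_) hM
    have := h i
    refine ((he.idem i).map j).isArtinian_span (fun y hyf hy => ?_)
      ((he.idem i).cornerEquivMap j hj hideal).isArtinianRing
    obtain ⟨a, ha⟩ := hideal y (e i)
    rw [hyf] at ha
    subst ha
    have ha0 : a = 0 := hR.eq_zero he fun r => hj (by rw [map_mul, map_mul, hy, map_zero])
    rw [ha0, map_zero]

/-! ### The artinian condition and the corners -/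

section Corners

variable {R : Type u} [NonUnitalRing R] {ι : Type w} {e : ι → R}

/-- The embedding of `R` into its unitization. -/
def inrRingHom (R : Type u) [NonUnitalRing R] : R →ₙ+* Unitization ℤ R where
  toFun := Unitization.inr
  map_mul' := Unitization.inr_mul ℤ
  map_add' := Unitization.inr_add ℤ
  map_zero' := Unitization.inr_zero ℤ

theorem inrRingHom_injective : Function.Injective (inrRingHom R) := Unitization.inr_injective

theorem exists_mul_inrRingHom_eq (v : Unitization ℤ R) (x : R) :
    ∃ y : R, v * inrRingHom R x = inrRingHom R y := by
  change ∃ y : R, v * (x : Unitization ℤ R) = (y : Unitization ℤ R)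
  induction v using Unitization.ind with
  | inl_add_inr n a =>
    exact ⟨n • x + a * x, by rw [add_mul, Unitization.inl_mul_inr, Unitization.inr_add,
      Unitization.inr_mul]⟩

theorem isUnitalVia_inrRingHom_iff {M : Type*} [AddCommGroup M] [Module (Unitization ℤ R) M] :
    IsUnitalVia (U := Unitization ℤ R) (inrRingHom R) M ↔ IsUnitalModule R M := Iff.rfl

theorem isNondegenerateVia_inrRingHom_iff {M : Type*} [AddCommGroup M]
    [Module (Unitization ℤ R) M] :
    IsNondegenerateVia (U := Unitization ℤ R) (inrRingHom R) M ↔ IsNondegenerateModule R M :=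
  Iff.rfl

theorem IsLocalUnitFamily.isCategoricallyLeftArtinian_iff (he : IsLocalUnitFamily e)
    (hR : IsSemiprimeRing R) :
    IsCategoricallyLeftArtinian R ↔ ∀ i, IsArtinianRing (he.idem i).Corner := by
  rw [← he.forall_isArtinian_iff (U := Unitization ℤ R) (j := inrRingHom R) inrRingHom_injective
    exists_mul_inrRingHom_eq hR]
  unfold IsCategoricallyLeftArtinian
  simp only [isUnitalVia_inrRingHom_iff, isNondegenerateVia_inrRingHom_iff]

theorem IsLocalUnitFamily.isCategoricallyRightArtinian_iff (he : IsLocalUnitFamily e)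
    (hR : IsSemiprimeRing R) :
    IsCategoricallyRightArtinian R ↔ ∀ i, IsArtinianRing (he.idem i).Cornerᵐᵒᵖ := by
  refine (he.op.isCategoricallyLeftArtinian_iff hR.op).trans (forall_congr' fun i => ?_)
  exact ⟨fun h => ((he.idem i).cornerOpEquiv (he.op.idem i)).symm.isArtinianRing,
    fun h => ((he.idem i).cornerOpEquiv (he.op.idem i)).isArtinianRing⟩

/-- For semiprime rings with local units the left and the right condition are equivalent, since
the corners are semiprime. -/
theorem IsLocalUnitFamily.isCategoricallyRightArtinian_iff_left (he : IsLocalUnitFamily e)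
    (hR : IsSemiprimeRing R) : IsCategoricallyRightArtinian R ↔ IsCategoricallyLeftArtinian R := by
  rw [he.isCategoricallyRightArtinian_iff hR, he.isCategoricallyLeftArtinian_iff hR]
  exact forall_congr' fun i => isArtinianRing_op_iff fun a ha =>
    Subtype.ext (hR.eq_zero he fun r => (he.idem i).corner_mul_mul_eq_zero ha r)

end Corners

/-! ### Subobjects in full subcategories of module categories -/

section Subobjects

open CategoryTheory

variable {U : Type*} [Ring U] {P : ObjectProperty (ModuleCat.{w} U)}
  (hP : ∀ M : ModuleCat.{w} U, P M → ∀ N : Submodule U M, P (ModuleCat.of U N))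
include hP

theorem ModuleCat.injective_of_mono_fullSubcategory {X Y : P.FullSubcategory} (f : X ⟶ Y)
    [Mono f] : Function.Injective f.hom.hom := by
  rw [← LinearMap.ker_eq_bot]
  let K : P.FullSubcategory := ⟨ModuleCat.of U (LinearMap.ker f.hom.hom), hP _ X.property _⟩
  let i : K ⟶ X := ObjectProperty.homMk (ModuleCat.ofHom (LinearMap.ker f.hom.hom).subtype)
  let z : K ⟶ X := ObjectProperty.homMk (ModuleCat.ofHom 0)
  have h : i ≫ f = z ≫ f := by
    ext x
    exact (LinearMap.mem_ker.1 x.2).trans (map_zero f.hom.hom).symm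
  have hiz : i = z := (cancel_mono f).1 h
  refine eq_bot_iff.2 fun x hx => ?_
  exact congrArg (fun g : K ⟶ X => g.hom.hom ⟨x, hx⟩) hiz

omit hP in
theorem ModuleCat.mono_fullSubcategory_of_injective {X Y : P.FullSubcategory} (f : X ⟶ Y)
    (hf : Function.Injective f.hom.hom) : Mono f := by
  refine ⟨fun g h hgh => ?_⟩
  ext x
  exact hf (congrArg (fun k => k.hom.hom x) hgh)

/-- The subobject of `X` given by a submodule. -/
def ModuleCat.fullSubcategoryOfSubmodule (X : P.FullSubcategory) (N : Submodule U X.obj) :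
    P.FullSubcategory := ⟨ModuleCat.of U N, hP _ X.property N⟩

/-- The inclusion of a submodule as a morphism of the full subcategory. -/
def ModuleCat.fullSubcategorySubtype (X : P.FullSubcategory) (N : Submodule U X.obj) :
    ModuleCat.fullSubcategoryOfSubmodule hP X N ⟶ X :=
  ObjectProperty.homMk (ModuleCat.ofHom N.subtype)

instance ModuleCat.mono_fullSubcategorySubtype (X : P.FullSubcategory) (N : Submodule U X.obj) :
    Mono (ModuleCat.fullSubcategorySubtype hP X N) :=
  ModuleCat.mono_fullSubcategory_of_injective _ N.injective_subtype

/-- In a full subcategory of modules that is closed under submodules, the subobjects of an object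
are its submodules. -/
noncomputable def ModuleCat.submoduleOrderIsoSubobject (X : P.FullSubcategory) :
    Submodule U X.obj ≃o Subobject X := by
  refine RelIso.ofSurjective (OrderEmbedding.ofMapLEIff
    (fun N => Subobject.mk (ModuleCat.fullSubcategorySubtype hP X N)) fun N N' => ?_) ?_
  · constructor
    · intro h x hx
      let g := Subobject.ofMkLEMk _ _ h
      have hg : g ≫ ModuleCat.fullSubcategorySubtype hP X N' =
        ModuleCat.fullSubcategorySubtype hP X N := Subobject.ofMkLEMk_comp h
      have := congrArg (fun k => k.hom.hom ⟨x, hx⟩) hg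
      change (g.hom.hom ⟨x, hx⟩).1 = x at this
      exact this ▸ (g.hom.hom ⟨x, hx⟩).2
    · intro h
      exact Subobject.mk_le_mk_of_comm
        (ObjectProperty.homMk (ModuleCat.ofHom (Submodule.inclusion h))) rfl
  · intro S
    induction S using Subobject.ind with
    | h f =>
      rename_i Y hf
      have hinj := ModuleCat.injective_of_mono_fullSubcategory hP f
      let E := LinearEquiv.ofInjective f.hom.hom hinj
      refine ⟨LinearMap.range f.hom.hom, le_antisymm ?_ ?_⟩
      · refine Subobject.mk_le_mk_of_comm
          (ObjectProperty.homMk (ModuleCat.ofHom E.symm.toLinearMap)) ?_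
        ext x
        exact congrArg Subtype.val (E.apply_symm_apply x)
      · exact Subobject.mk_le_mk_of_comm
          (ObjectProperty.homMk (ModuleCat.ofHom E.toLinearMap)) rfl

end Subobjects

/-! ### Morita invariance -/

section Equivalence

open CategoryTheory

theorem OrderIso.isCompactElement_apply {α β : Type*} [PartialOrder α] [PartialOrder β]
    (f : α ≃o β) {a : α} (ha : IsCompactElement a) : IsCompactElement (f a) := by
  intro s u hs hdir hu hau
  have hdir' : DirectedOn (· ≤ ·) (f.symm '' s) := by
    rintro _ ⟨x, hx, rfl⟩ _ ⟨y, hy, rfl⟩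
    obtain ⟨z, hz, hxz, hyz⟩ := hdir x hx y hy
    exact ⟨_, ⟨z, hz, rfl⟩, f.symm.monotone hxz, f.symm.monotone hyz⟩
  obtain ⟨_, ⟨x, hx, rfl⟩, hax⟩ := ha (f.symm '' s) (f.symm u) (hs.image _) hdir'
    (f.symm.isLUB_image'.2 hu) (f.le_symm_apply.2 hau)
  exact ⟨x, hx, f.le_symm_apply.1 hax⟩

theorem isArtinian_of_submodule_orderIso {U V M N : Type*} [Ring U] [Ring V] [AddCommGroup M]
    [AddCommGroup N] [Module U M] [Module V N] (f : Submodule U M ≃o Submodule V N)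
    [IsArtinian V N] : IsArtinian U M :=
  f.strictMono.wellFoundedLT

theorem Module.Finite.of_submodule_orderIso {U V M N : Type*} [Ring U] [Ring V] [AddCommGroup M]
    [AddCommGroup N] [Module U M] [Module V N] (f : Submodule U M ≃o Submodule V N)
    [Module.Finite U M] : Module.Finite V N := by
  rw [Module.finite_def, Submodule.fg_iff_compact, ← map_top f]
  exact f.isCompactElement_apply ((Submodule.fg_iff_compact _).1 Module.Finite.fg_top)

/-- Let two categories of modules, both closed under submodules, be equivalent. An equivalence
preserves lattices of subobjects, and the finitely generated modules (the top submodule is compact)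
and the artinian modules are determined by these. -/
theorem ModuleCat.isArtinian_of_equivalence {U V : Type*} [Ring U] [Ring V]
    {P : ObjectProperty (ModuleCat.{w} U)} {Q : ObjectProperty (ModuleCat.{w} V)}
    (hP : ∀ M : ModuleCat.{w} U, P M → ∀ N : Submodule U M, P (ModuleCat.of U N))
    (hQ : ∀ M : ModuleCat.{w} V, Q M → ∀ N : Submodule V M, Q (ModuleCat.of V N))
    (F : P.FullSubcategory ≌ Q.FullSubcategory)
    (hart : ∀ M : ModuleCat.{w} U, P M → Module.Finite U M → IsArtinian U M)
    (M : ModuleCat.{w} V) (hM : Q M) [Module.Finite V M] : IsArtinian V M := by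
  let X : Q.FullSubcategory := ⟨M, hM⟩
  let Y : P.FullSubcategory := F.symm.functor.obj X
  let f : Submodule V M ≃o Submodule U Y.obj :=
    (ModuleCat.submoduleOrderIsoSubobject hQ X).trans
      ((Subobject.lowerEquivalence (MonoOver.congr X F.symm)).toOrderIso.trans
        (ModuleCat.submoduleOrderIsoSubobject hP Y).symm)
  have := hart Y.obj Y.property (Module.Finite.of_submodule_orderIso f)
  exact isArtinian_of_submodule_orderIso f

/-- If `R` has local units then `R`-Mod is closed under submodules. -/
theorem IsLocalUnitFamily.rmod_submodule {R : Type u} [NonUnitalRing R] {ι : Type*} {e : ι → R}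
    (he : IsLocalUnitFamily e) (M : ModuleCat.{u} (Unitization ℤ R))
    (hM : IsUnitalModule R M ∧ IsNondegenerateModule R M) (N : Submodule (Unitization ℤ R) M) :
    IsUnitalModule R (ModuleCat.of (Unitization ℤ R) N) ∧
      IsNondegenerateModule R (ModuleCat.of (Unitization ℤ R) N) :=
  ⟨isUnitalVia_inrRingHom_iff.1
      (he.isUnitalVia_submodule (isUnitalVia_inrRingHom_iff.2 hM.1) N),
    isNondegenerateVia_inrRingHom_iff.1
      ((isNondegenerateVia_inrRingHom_iff.2 hM.2).submodule N)⟩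

theorem IsCategoricallyLeftArtinian.of_moritaEquivalent {R S : Type u} [NonUnitalRing R]
    [NonUnitalRing S] (hR : HasEnoughIdempotents R) (hS : HasEnoughIdempotents S)
    (h : MoritaEquivalent R S) (hart : IsCategoricallyLeftArtinian R) :
    IsCategoricallyLeftArtinian S := by
  obtain ⟨E, hE⟩ := hR
  obtain ⟨E', hE'⟩ := hS
  obtain ⟨F⟩ := h
  intro M _ _ hM hM' _
  exact ModuleCat.isArtinian_of_equivalence hE.isLocalUnitFamily.rmod_submodule
    hE'.isLocalUnitFamily.rmod_submodule F (fun N hN hfin => hart N hN.1 hN.2 hfin)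
    (ModuleCat.of (Unitization ℤ S) M) ⟨hM, hM'⟩

end Equivalence

theorem theorem2p8 :
    -- both properties are Morita invariant for semiprime rings with enough idempotents
    (IsMoritaInvariant.{u} IsSemiprimeWithEnoughIdempotents IsCategoricallyLeftArtinian ∧
      IsMoritaInvariant.{u} IsSemiprimeWithEnoughIdempotents IsCategoricallyRightArtinian) ∧
    -- both properties can be read off the corners at any complete family of idempotents
    (∀ (R : Type u) [NonUnitalRing R], IsSemiprimeRing R →
      ∀ (ι : Type w) (e : ι → R) (he : IsCompleteIdempotents e),
        (IsCategoricallyLeftArtinian R ↔ ∀ i, IsArtinianRing (he.idem i).Corner) ∧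
        (IsCategoricallyRightArtinian R ↔ ∀ i, IsArtinianRing (he.idem i).Cornerᵐᵒᵖ)) := by
  refine ⟨⟨fun R S _ _ hR hS h => IsCategoricallyLeftArtinian.of_moritaEquivalent hR.2 hS.2 h,
    fun R S _ _ hR hS h => ?_⟩, fun R _ hR ι e he =>
      ⟨he.isLocalUnitFamily.isCategoricallyLeftArtinian_iff hR,
        he.isLocalUnitFamily.isCategoricallyRightArtinian_iff hR⟩⟩
  obtain ⟨E, hE⟩ := hR.2
  obtain ⟨E', hE'⟩ := hS.2
  rw [hE.isLocalUnitFamily.isCategoricallyRightArtinian_iff_left hR.1,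
    hE'.isLocalUnitFamily.isCategoricallyRightArtinian_iff_left hS.1]
  exact IsCategoricallyLeftArtinian.of_moritaEquivalent hR.2 hS.2 h
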